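/- Let $0<\theta_{hl}<\theta_+$ and $q>0$ be real numbers. Let $W\subset\mathbb R$ be an open set containing $[\theta_{hl},\theta_+]$ and let $F$ be a real function that is $C^\infty$ on $W$, whose only zero in $W$ is $\theta_+$, and with $F'(\theta_+)<0$. For $c\ge 0$ consider on $W\times\mathbb R$ the system $$u'=v,\qquad v'=cv-F(u),$$ and let $S_c$ be the stable separatrix of its saddle point $(\theta_+,0)$, i.e. the set of points of $[\theta_{hl},\theta_+]\times[0,\infty)$ whose forward trajectory is defined for all $t\ge 0$, stays in $W\times\mathbb R$, and tends to $(\theta_+,0)$ as $t\to+\infty$. Then there is a function $\psi:[0,\infty)\to\mathbb R$ such that for all $R\ge 0$ and $c\ge 0$ $$(\theta_{hl},\,c\,\theta_{hl}-qR)\in S_c\iff c=\psi(R),$$ and the following hold: (i) $\psi$ is a $C^\infty$ diffeomorphism from $[0,+\infty)$ onto $[\psi(0),+\infty)$, and $\psi(0)>0$; (ii) $\psi$ is strictly increasing, $\psi(R)\to+\infty$ as $R\to+\infty$, and its graph has the line $c=qR/\theta_{hl}$ as an asymptote, i.e. $\psi(R)-qR/\theta_{hl}\to 0$ as $R\to+\infty$;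 (iii) for all $R\ge 0$, $$\frac{qR}{\theta_{hl}}<\psi(R)<c_+(R),\qquad c_+(R)=\frac1{\theta_{hl}}\Big(\Big(2\int_{\theta_{hl}}^{\theta_+}F(u)\,du\Big)^{1/2}+qR\Big).$$ -/

import Mathlib

open Set Filter Topology

/-- The planar vector field `X_c(u, v) = (v, c v - F(u))`. -/
def vectorField (F : ℝ → ℝ) (c : ℝ) (p : ℝ × ℝ) : ℝ × ℝ :=
  (p.2, c * p.2 - F p.1)

/-- The (global) stable manifold of the point `p₀` for the field `X_c` considered on `W × ℝ`:
the points whose forward trajectory exists for all times, stays in `W × ℝ` and tends to `p₀`.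
Only the values of `F` on `W` matter. -/
def stableManifold (F : ℝ → ℝ) (W : Set ℝ) (c : ℝ) (p₀ : ℝ × ℝ) : Set (ℝ × ℝ) :=
  {p | ∃ γ : ℝ → ℝ × ℝ, γ 0 = p ∧
    IsIntegralCurveOn γ (fun _ => vectorField F c) (Ici 0) ∧
    (∀ t ∈ Ici (0 : ℝ), (γ t).1 ∈ W) ∧
    Tendsto γ atTop (𝓝 p₀)}

/-- The stable separatrix `S_c` of the saddle `(b, 0)`: the half of its stable manifold located
in the region `[a, b] × [0, ∞)`. -/
def stableSeparatrix (F : ℝ → ℝ) (W : Set ℝ) (a b c : ℝ) : Set (ℝ × ℝ) :=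
  stableManifold F W c (b, 0) ∩ Icc a b ×ˢ Ici 0

/-- `f` maps the interval `s` of the real line diffeomorphically (in the `C^∞` sense)
onto the interval `t`. -/
def IsSmoothDiffeoOn (f : ℝ → ℝ) (s t : Set ℝ) : Prop :=
  BijOn f s t ∧ ContDiffOn ℝ (⊤ : ℕ∞) f s ∧
    ∃ g : ℝ → ℝ, ContDiffOn ℝ (⊤ : ℕ∞) g t ∧ InvOn g f s t

/-! Write `a`, `b` for the two thresholds and set `x = (b - u)/(b - a)`, `C = (b - a)c`. As `b` is a
simple zero of `F`, `F(u) = x k(x)/(b - a)` with `k` continuous and positive on `[0, 1]`. A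
separatrix `v = x m(x)` then solves `(x m)' = k/m - C`, and positivity of `m` up to `x = 0` selects
the stable direction of the saddle.

Adding `n m` to both sides gives `x m' + (n + 1) m = k/m + n m - C`, whose left side is inverted by
an averaging operator of norm at most `1/(n + 1)`. For large `n` the map `m ↦ k/m + n m` is
increasing and `n`-Lipschitz where `m ≥ δ`. Hence a contraction gives existence, a maximum principle
gives uniqueness and monotonicity in `C`, and the inverse function theorem in `C([0, 1])` gives
smoothness in `C` (`exists_isRegularSolution`, `IsRegularSolution.le_of_le`,
`contDiff_regularSolution`).

The separatrix meets `u = a` only at height `Φ(c) = m(1)`, a smooth, positive, antitone function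
tending to `0`. The condition on `(R, c)` becomes `c a - Φ(c) = q R`, whose left side is a
diffeomorphism of the line in `c`; `ψ` is its inverse. The bounds and the asymptote are estimates of
`Φ`, the upper one being an energy inequality. -/

/-! ### Averaging operators on `C([0, 1])` -/

/-- The averaging operator `f ↦ (x ↦ ∫ t in 0..1, t ^ n * f (t * x))` on `C([0, 1])`. -/
noncomputable def weightedMean (n : ℕ) : C(unitInterval, ℝ) →L[ℝ] C(unitInterval, ℝ) :=
  LinearMap.mkContinuous
    { toFun := fun f =>
        { toFun := fun x => ∫ t in (0 : ℝ)..1, t ^ n * IccExtend zero_le_one f (t * x)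
          continuous_toFun := by
            apply intervalIntegral.continuous_parametric_intervalIntegral_of_continuous'
            have := f.continuous.Icc_extend' (h := zero_le_one)
            fun_prop }
      map_add' := fun f g => by
        ext x
        have hf := f.continuous.Icc_extend' (h := zero_le_one)
        have hg := g.continuous.Icc_extend' (h := zero_le_one)
        simp only [ContinuousMap.coe_mk, ContinuousMap.add_apply]
        rw [← intervalIntegral.integral_add]
        · refine intervalIntegral.integral_congr fun t _ => ?_
          simp only [IccExtend, Function.comp_apply, ContinuousMap.add_apply]
          ring
        · exact Continuous.intervalIntegrable (by fun_prop) _ _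
        · exact Continuous.intervalIntegrable (by fun_prop) _ _
      map_smul' := fun r f => by
        ext x
        simp only [ContinuousMap.coe_mk, ContinuousMap.smul_apply, smul_eq_mul, RingHom.id_apply]
        rw [← intervalIntegral.integral_const_mul]
        refine intervalIntegral.integral_congr fun t _ => ?_
        simp only [IccExtend, Function.comp_apply, ContinuousMap.smul_apply, smul_eq_mul]
        ring }
    1 (fun f => by
      rw [one_mul, ContinuousMap.norm_le _ (norm_nonneg _)]
      intro x
      have h : ∀ t ∈ uIoc (0 : ℝ) 1, ‖t ^ n * IccExtend zero_le_one f (t * x)‖ ≤ ‖f‖ := by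
        intro t ht
        rw [uIoc_of_le zero_le_one] at ht
        rw [norm_mul, norm_pow]
        calc _ ≤ 1 * ‖f‖ := by
              gcongr
              · exact pow_le_one₀ (norm_nonneg _) (by
                  rw [Real.norm_of_nonneg ht.1.le]; exact ht.2)
              · exact f.norm_coe_le_norm _
          _ = ‖f‖ := one_mul _
      simpa using intervalIntegral.norm_integral_le_of_norm_le_const h)

theorem weightedMean_apply (n : ℕ) (f : C(unitInterval, ℝ)) (x : unitInterval) :
    weightedMean n f x = ∫ t in (0 : ℝ)..1, t ^ n * IccExtend zero_le_one f (t * x) := rfl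

theorem weightedMean_apply_le {n : ℕ} {f : C(unitInterval, ℝ)} {B : ℝ} (h : ∀ x, f x ≤ B)
    (x : unitInterval) : weightedMean n f x ≤ B / (n + 1) := by
  have hf := f.continuous.Icc_extend' (h := zero_le_one)
  have h1 : ∫ t in (0 : ℝ)..1, t ^ n * B = B / (n + 1) := by
    rw [intervalIntegral.integral_mul_const, integral_pow]
    simp
    ring
  rw [weightedMean_apply, ← h1]
  refine intervalIntegral.integral_mono_on zero_le_one ?_ ?_ fun t ht => ?_
  · exact Continuous.intervalIntegrable (by fun_prop) _ _
  · exact Continuous.intervalIntegrable (by fun_prop) _ _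
  · exact mul_le_mul_of_nonneg_left (h _) (pow_nonneg ht.1 n)

theorem le_weightedMean_apply {n : ℕ} {f : C(unitInterval, ℝ)} {B : ℝ} (h : ∀ x, B ≤ f x)
    (x : unitInterval) : B / (n + 1) ≤ weightedMean n f x := by
  have := weightedMean_apply_le (n := n) (f := -f) (B := -B) (fun x => neg_le_neg (h x)) x
  rw [map_neg, ContinuousMap.neg_apply, neg_div] at this
  linarith

theorem norm_weightedMean_le (n : ℕ) (f : C(unitInterval, ℝ)) :
    ‖weightedMean n f‖ ≤ ‖f‖ / (n + 1) := by
  rw [ContinuousMap.norm_le _ (by positivity)]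
  intro x
  rw [Real.norm_eq_abs, abs_le]
  constructor
  · rw [← neg_div]
    exact le_weightedMean_apply (fun y => (abs_le.1 (f.norm_coe_le_norm y)).1) x
  · exact weightedMean_apply_le (fun y => (abs_le.1 (f.norm_coe_le_norm y)).2) x

theorem weightedMean_const (n : ℕ) (r : ℝ) :
    weightedMean n (ContinuousMap.const _ r) = ContinuousMap.const _ (r / (n + 1)) := by
  ext x
  exact le_antisymm (weightedMean_apply_le (fun _ => le_rfl) x)
    (le_weightedMean_apply (fun _ => le_rfl) x)

/-- The monomial `x ^ j` as a continuous function on `[0, 1]`. -/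
def unitMonomial (j : ℕ) : C(unitInterval, ℝ) := ⟨fun x => (x : ℝ) ^ j, by fun_prop⟩

theorem weightedMean_unitMonomial (n j : ℕ) :
    weightedMean n (unitMonomial j) = (1 / (n + j + 1) : ℝ) • unitMonomial j := by
  ext x
  rw [weightedMean_apply]
  have : ∫ t in (0 : ℝ)..1, t ^ n * IccExtend zero_le_one (unitMonomial j) (t * x)
      = ∫ t in (0 : ℝ)..1, t ^ (n + j) * (x : ℝ) ^ j := by
    refine intervalIntegral.integral_congr fun t ht => ?_
    rw [uIcc_of_le zero_le_one] at ht
    have hm : t * x ∈ Icc (0 : ℝ) 1 :=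
      ⟨mul_nonneg ht.1 x.2.1, mul_le_one₀ ht.2 x.2.1 x.2.2⟩
    change t ^ n * IccExtend zero_le_one (unitMonomial j) (t * x) = t ^ (n + j) * (x : ℝ) ^ j
    rw [IccExtend_of_mem _ _ hm]
    simp only [unitMonomial, ContinuousMap.coe_mk]
    rw [mul_pow, pow_add]
    ring
  rw [this, intervalIntegral.integral_mul_const, integral_pow]
  simp [unitMonomial]

/-- Polynomials are dense. The averaging operators are diagonal on monomials, so their identities
reduce to arithmetic of the eigenvalues `1/(n + j + 1)`. -/
theorem clm_ext_unitMonomial {S T : C(unitInterval, ℝ) →L[ℝ] C(unitInterval, ℝ)}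
    (h : ∀ j, S (unitMonomial j) = T (unitMonomial j)) : S = T := by
  have hpoly : ∀ p : Polynomial ℝ,
      S (p.toContinuousMapOn unitInterval) = T (p.toContinuousMapOn unitInterval) := by
    intro p
    induction p using Polynomial.induction_on' with
    | add p q hp hq =>
      have : (p + q).toContinuousMapOn unitInterval
          = p.toContinuousMapOn unitInterval + q.toContinuousMapOn unitInterval := by
        ext x; simp
      rw [this, map_add, map_add, hp, hq]
    | monomial j r =>
      have : (Polynomial.monomial j r).toContinuousMapOn unitInterval = r • unitMonomial j := by
        ext x; simp [unitMonomial]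
      rw [this, map_smul, map_smul, h]
  ext1 f
  have hcl : IsClosed {f | S f = T f} := isClosed_eq S.continuous T.continuous
  have hmem : f ∈ closure (polynomialFunctions unitInterval : Set C(unitInterval, ℝ)) := by
    rw [← Subalgebra.topologicalClosure_coe, polynomialFunctions_closure_eq_top']; trivial
  refine closure_minimal ?_ hcl hmem
  rw [polynomialFunctions_coe]
  rintro _ ⟨p, rfl⟩
  exact hpoly p

theorem weightedMean_add_smul_zero (n : ℕ) (f : C(unitInterval, ℝ)) :
    weightedMean n (f + (n : ℝ) • weightedMean 0 f) = weightedMean 0 f := by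
  have : weightedMean n ∘L (.id ℝ _ + (n : ℝ) • weightedMean 0) = weightedMean 0 := by
    refine clm_ext_unitMonomial fun j => ?_
    ext x
    simp [weightedMean_unitMonomial]
    field_simp
    ring
  exact DFunLike.congr_fun this f

theorem weightedMean_zero_add_smul (n : ℕ) (f : C(unitInterval, ℝ)) :
    weightedMean n f + (n : ℝ) • weightedMean 0 (weightedMean n f) = weightedMean 0 f := by
  have : (.id ℝ _ + (n : ℝ) • weightedMean 0) ∘L weightedMean n = weightedMean 0 := by
    refine clm_ext_unitMonomial fun j => ?_
    ext x
    simp [weightedMean_unitMonomial]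
    field_simp
    ring
  exact DFunLike.congr_fun this f

/-- Formally the two sides are `x m' + m = f` and `x m' + (n + 1) m = f + n m`. The second form has
the smaller operator norm, and no differentiability of `m` is needed at `0`. -/
theorem eq_weightedMean_iff (n : ℕ) (m f : C(unitInterval, ℝ)) :
    m = weightedMean 0 f ↔ m = weightedMean n (f + (n : ℝ) • m) := by
  constructor
  · rintro rfl
    exact (weightedMean_add_smul_zero n f).symm
  · intro h
    have h1 := weightedMean_zero_add_smul n (f + (n : ℝ) • m)
    rw [← h, map_add, map_smul] at h1
    exact add_right_cancel h1

theorem mul_weightedMean_zero_apply (f : C(unitInterval, ℝ)) (x : unitInterval) :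
    x * weightedMean 0 f x = ∫ y in (0 : ℝ)..x, IccExtend zero_le_one f y := by
  rw [weightedMean_apply]
  simp only [pow_zero, one_mul]
  rw [intervalIntegral.mul_integral_comp_mul_right]
  simp

/-! ### The singular equation: comparison, bounds, existence -/

/-- `m` is a positive continuous solution on `[0, 1]` of the singular equation
`(x m)' = k / m - C`, in integrated form. -/
def IsRegularSolution (k : C(unitInterval, ℝ)) (C : ℝ) (m : C(unitInterval, ℝ)) : Prop :=
  (∀ x, 0 < m x) ∧ m = weightedMean 0 (k * Ring.inverse m - ContinuousMap.const _ C)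

theorem ringInverse_apply {m : C(unitInterval, ℝ)} (hm : ∀ x, 0 < m x) (x : unitInterval) :
    Ring.inverse m x = (m x)⁻¹ := by
  have hu : IsUnit m := (ContinuousMap.isUnit_iff_forall_ne_zero m).2 fun x => (hm x).ne'
  have h := congrArg (fun f : C(unitInterval, ℝ) => f x) (Ring.mul_inverse_cancel m hu)
  simp only [ContinuousMap.mul_apply, ContinuousMap.one_apply] at h
  exact eq_inv_of_mul_eq_one_right h

theorem exists_pos_le_apply {m : C(unitInterval, ℝ)} (hm : ∀ x, 0 < m x) :
    ∃ δ > 0, ∀ x, δ ≤ m x := by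
  obtain ⟨x₀, -, h⟩ := isCompact_univ.exists_isMinOn univ_nonempty m.continuous.continuousOn
  exact ⟨m x₀, hm x₀, fun x => h (mem_univ x)⟩

theorem exists_nat_dominating (k : C(unitInterval, ℝ)) {δ : ℝ} (hδ : 0 < δ) :
    ∃ n : ℕ, ∀ x, k x ≤ n * δ ^ 2 := by
  obtain ⟨n, hn⟩ := exists_nat_ge (‖k‖ / δ ^ 2)
  refine ⟨n, fun x => ((le_abs_self _).trans (k.norm_coe_le_norm x)).trans ?_⟩
  rwa [div_le_iff₀ (by positivity)] at hn

/-- The function `r ↦ k/r + n r` has slope `n - k/r²` in `[0, n]` for `r ≥ δ`. Taking `D = 0` gives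
monotonicity. -/
theorem div_add_mul_sub_le {k n δ p r D : ℝ} (hk : 0 < k) (hn : 0 ≤ n) (hδ : 0 < δ)
    (hkn : k ≤ n * δ ^ 2) (hp : δ ≤ p) (hr : δ ≤ r) (hD : 0 ≤ D) (hrp : r - p ≤ D) :
    (k / r + n * r) - (k / p + n * p) ≤ n * D := by
  have hp0 := hδ.trans_le hp
  have hr0 := hδ.trans_le hr
  have e : (k / r + n * r) - (k / p + n * p) = (r - p) * (n - k / (r * p)) := by
    field_simp
    ring
  have h1 : k / (r * p) ≤ n := by
    rw [div_le_iff₀ (by positivity)]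
    refine hkn.trans (mul_le_mul_of_nonneg_left ?_ hn)
    rw [sq]
    exact mul_le_mul hr hp hδ.le hr0.le
  have h2 : 0 ≤ k / (r * p) := by positivity
  rw [e]
  rcases le_total r p with h | h
  · exact (mul_nonpos_of_nonpos_of_nonneg (by linarith) (by linarith)).trans (by positivity)
  · calc (r - p) * (n - k / (r * p)) ≤ (r - p) * n :=
        mul_le_mul_of_nonneg_left (by linarith) (by linarith)
      _ ≤ D * n := mul_le_mul_of_nonneg_right hrp hn
      _ = n * D := mul_comm _ _

theorem IsRegularSolution.eq_weightedMean {k m : C(unitInterval, ℝ)} {C : ℝ}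
    (h : IsRegularSolution k C m) (n : ℕ) :
    m = weightedMean n (k * Ring.inverse m - ContinuousMap.const _ C + (n : ℝ) • m) :=
  (eq_weightedMean_iff n _ _).1 h.2

/-- Maximum principle: a positive maximum `D` of `m₂ - m₁` would satisfy `D ≤ n D/(n + 1)`. -/
theorem IsRegularSolution.le_of_le {k m₁ m₂ : C(unitInterval, ℝ)} {C₁ C₂ : ℝ}
    (hk : ∀ x, 0 < k x) (h₁ : IsRegularSolution k C₁ m₁) (h₂ : IsRegularSolution k C₂ m₂)
    (hC : C₁ ≤ C₂) (x : unitInterval) : m₂ x ≤ m₁ x := by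
  obtain ⟨δ₁, hδ₁, hm₁⟩ := exists_pos_le_apply h₁.1
  obtain ⟨δ₂, hδ₂, hm₂⟩ := exists_pos_le_apply h₂.1
  obtain ⟨n, hn⟩ := exists_nat_dominating k (lt_min hδ₁ hδ₂)
  obtain ⟨x₀, -, hx₀⟩ :=
    isCompact_univ.exists_isMaxOn univ_nonempty (m₂ - m₁).continuous.continuousOn
  have hmax : ∀ y, m₂ y - m₁ y ≤ (m₂ - m₁) x₀ := fun y => hx₀ (mem_univ y)
  by_contra! hlt
  have hD : 0 < (m₂ - m₁) x₀ := (sub_pos.2 hlt).trans_le (hmax x)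
  have key := weightedMean_apply_le (n := n) (B := n * (m₂ - m₁) x₀)
    (f := (k * Ring.inverse m₂ - ContinuousMap.const _ C₂ + (n : ℝ) • m₂)
      - (k * Ring.inverse m₁ - ContinuousMap.const _ C₁ + (n : ℝ) • m₁)) (fun y => by
        have := div_add_mul_sub_le (hk y) n.cast_nonneg (lt_min hδ₁ hδ₂) (hn y)
          ((min_le_left _ _).trans (hm₁ y)) ((min_le_right _ _).trans (hm₂ y)) hD.le (hmax y)
        simp only [ContinuousMap.sub_apply, ContinuousMap.add_apply, ContinuousMap.mul_apply,
          ContinuousMap.const_apply, ContinuousMap.smul_apply, smul_eq_mul,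
          ringInverse_apply h₁.1, ringInverse_apply h₂.1] at this ⊢
        rw [div_eq_mul_inv, div_eq_mul_inv] at this
        linarith) x₀
  rw [map_sub, ← h₁.eq_weightedMean n, ← h₂.eq_weightedMean n, le_div_iff₀ (by positivity)] at key
  linarith

theorem IsRegularSolution.unique {k m₁ m₂ : C(unitInterval, ℝ)} {C : ℝ}
    (hk : ∀ x, 0 < k x) (h₁ : IsRegularSolution k C m₁) (h₂ : IsRegularSolution k C m₂) :
    m₁ = m₂ := by
  ext x
  exact le_antisymm (h₂.le_of_le hk h₁ le_rfl x) (h₁.le_of_le hk h₂ le_rfl x)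

/-- At the maximum `M` of `m`, averaging gives `(n + 1) M ≤ ‖k‖/M + n M - C`, hence `C ≤ ‖k‖/M`. -/
theorem IsRegularSolution.mul_apply_le_norm {k m : C(unitInterval, ℝ)} {C : ℝ}
    (hk : ∀ x, 0 < k x) (h : IsRegularSolution k C m) (hC : 0 ≤ C) (x : unitInterval) :
    C * m x ≤ ‖k‖ := by
  obtain ⟨δ, hδ, hm⟩ := exists_pos_le_apply h.1
  obtain ⟨n, hn⟩ := exists_nat_dominating k hδ
  obtain ⟨x₀, -, hx₀⟩ :=
    isCompact_univ.exists_isMaxOn univ_nonempty m.continuous.continuousOn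
  have hmax : ∀ y, m y ≤ m x₀ := fun y => hx₀ (mem_univ y)
  have hX := h.1 x₀
  have key := weightedMean_apply_le (n := n) (B := ‖k‖ / m x₀ + n * m x₀ - C)
    (f := k * Ring.inverse m - ContinuousMap.const _ C + (n : ℝ) • m) (fun y => by
        have h1 := div_add_mul_sub_le (hk y) n.cast_nonneg hδ (hn y)
          (hm x₀) (hm y) le_rfl (sub_nonpos.2 (hmax y))
        have h2 : k y / m x₀ ≤ ‖k‖ / m x₀ :=
          div_le_div_of_nonneg_right ((le_abs_self _).trans (k.norm_coe_le_norm y)) hX.le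
        simp only [ContinuousMap.sub_apply, ContinuousMap.add_apply, ContinuousMap.mul_apply,
          ContinuousMap.const_apply, ContinuousMap.smul_apply, smul_eq_mul,
          ringInverse_apply h.1]
        rw [div_eq_mul_inv (k y) (m y)] at h1
        linarith) x₀
  rw [← h.eq_weightedMean n, le_div_iff₀ (by positivity)] at key
  have h3 : C ≤ ‖k‖ / m x₀ := by linarith
  rw [le_div_iff₀ hX] at h3
  exact (mul_le_mul_of_nonneg_left (hmax x) hC).trans h3

/-- Truncating `m` at `δ` makes the map a contraction of all of `C([0, 1])`; its fixed point stays
above `δ`, so the truncation is inactive. -/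
theorem exists_isRegularSolution {k : C(unitInterval, ℝ)} (hk : ∀ x, 0 < k x) (C : ℝ) :
    ∃ m, IsRegularSolution k C m := by
  obtain ⟨κ, hκ, hkκ⟩ := exists_pos_le_apply hk
  have hC1 : 0 < 1 + |C| := by positivity
  -- This inequality says `δ + C ≤ k/δ`: the constant `δ` is a subsolution.
  obtain ⟨δ, hδ, hδκ⟩ : ∃ δ > 0, δ ^ 2 + C * δ ≤ κ := by
    refine ⟨min 1 (κ / (1 + |C|)), by positivity, ?_⟩
    set δ := min 1 (κ / (1 + |C|))
    have h0 : 0 < δ := by positivity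
    have h1 : δ ≤ 1 := min_le_left _ _
    have h2 : δ * (1 + |C|) ≤ κ := (le_div_iff₀ hC1).1 (min_le_right _ _)
    nlinarith [le_abs_self C]
  obtain ⟨n, hn⟩ := exists_nat_dominating k hδ
  have hmax : ∀ y : ℝ, max y δ ≠ 0 := fun y => (hδ.trans_le (le_max_right _ _)).ne'
  let N : C(unitInterval, ℝ) → C(unitInterval, ℝ) := fun m =>
    ⟨fun x => k x / max (m x) δ + n * max (m x) δ - C, by
      fun_prop (disch := intro x; exact hmax _)⟩
  have hN : ∀ m x, N m x = k x / max (m x) δ + n * max (m x) δ - C := fun m x => rfl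
  have hNlip : ∀ m₁ m₂, ‖N m₁ - N m₂‖ ≤ n * ‖m₁ - m₂‖ := by
    intro m₁ m₂
    rw [ContinuousMap.norm_le _ (by positivity)]
    intro x
    have hx : |max (m₁ x) δ - max (m₂ x) δ| ≤ ‖m₁ - m₂‖ :=
      (abs_max_sub_max_le_abs _ _ _).trans ((m₁ - m₂).norm_coe_le_norm x)
    have h1 := div_add_mul_sub_le (hk x) n.cast_nonneg hδ (hn x)
      (le_max_right (m₂ x) δ) (le_max_right (m₁ x) δ) (norm_nonneg _) (le_of_abs_le hx)
    have h2 := div_add_mul_sub_le (hk x) n.cast_nonneg hδ (hn x)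
      (le_max_right (m₁ x) δ) (le_max_right (m₂ x) δ) (norm_nonneg _)
      (le_of_abs_le ((abs_sub_comm _ _).trans_le hx))
    rw [ContinuousMap.sub_apply, hN, hN, Real.norm_eq_abs, abs_le]
    constructor <;> linarith
  have hT : ContractingWith ((n : NNReal) / (n + 1)) fun m => weightedMean n (N m) := by
    refine ⟨?_, LipschitzWith.of_dist_le_mul fun m₁ m₂ => ?_⟩
    · exact (div_lt_one (by positivity)).2 (lt_add_one _)
    · rw [dist_eq_norm, dist_eq_norm, ← map_sub]
      refine (norm_weightedMean_le _ _).trans ?_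
      calc ‖N m₁ - N m₂‖ / (n + 1) ≤ n * ‖m₁ - m₂‖ / (n + 1) := by gcongr; exact hNlip _ _
        _ = ((n : NNReal) / (n + 1) : NNReal) * ‖m₁ - m₂‖ := by push_cast; ring
  obtain ⟨m, hm⟩ : ∃ m, weightedMean n (N m) = m := ⟨_, hT.fixedPoint_isFixedPt⟩
  have hmδ : ∀ x, δ ≤ m x := by
    intro x
    rw [← hm]
    refine le_trans ?_ (le_weightedMean_apply (B := (n + 1) * δ) (fun y => ?_) x)
    · field_simp; rfl
    · have h1 := div_add_mul_sub_le (hk y) n.cast_nonneg hδ (hn y)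
        (le_max_right (m y) δ) le_rfl le_rfl (sub_nonpos.2 (le_max_right (m y) δ))
      have h2 : δ + C ≤ k y / δ := by
        rw [le_div_iff₀ hδ]
        nlinarith [hkκ y]
      rw [hN]
      linarith
  have hpos : ∀ x, 0 < m x := fun x => hδ.trans_le (hmδ x)
  refine ⟨m, hpos, (eq_weightedMean_iff n _ _).2 ?_⟩
  conv_lhs => rw [← hm]
  congr 1
  ext x
  rw [hN, max_eq_left (hmδ x)]
  simp only [ContinuousMap.sub_apply, ContinuousMap.add_apply, ContinuousMap.mul_apply,
    ContinuousMap.const_apply, ContinuousMap.smul_apply, smul_eq_mul, ringInverse_apply hpos]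
  ring

/-! ### Smooth dependence on the parameter -/

/-- Isolating `C` as a constant function on the right lets the inverse function theorem replace the
implicit one. -/
theorem isRegularSolution_iff {k m : C(unitInterval, ℝ)} {C : ℝ} (hm : ∀ x, 0 < m x) (n : ℕ) :
    IsRegularSolution k C m ↔
      m - weightedMean n (k * Ring.inverse m + (n : ℝ) • m) =
        (-(C / (n + 1))) • (1 : C(unitInterval, ℝ)) := by
  have hc : (-(C / (n + 1))) • (1 : C(unitInterval, ℝ)) =
      - ContinuousMap.const _ (C / (n + 1)) := by
    ext x; simp
  rw [IsRegularSolution, and_iff_right hm, eq_weightedMean_iff n, hc, ← weightedMean_const,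
    sub_add_eq_add_sub, map_sub, sub_eq_iff_eq_add, sub_eq_neg_add]

/-- The derivative is the identity minus the average of multiplication by `n - k/m²`, which lies in
`[0, n]`. The subtracted operator has norm at most `n/(n + 1)`, so a Neumann series inverts the
derivative. -/
theorem hasFDerivAt_regularSolutionMap {k m : C(unitInterval, ℝ)} (hk : ∀ x, 0 < k x)
    (hm : ∀ x, 0 < m x) :
    ∃ n : ℕ, ∃ f' : C(unitInterval, ℝ) ≃L[ℝ] C(unitInterval, ℝ),
      HasFDerivAt (fun m => m - weightedMean n (k * Ring.inverse m + (n : ℝ) • m))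
        (f' : C(unitInterval, ℝ) →L[ℝ] C(unitInterval, ℝ)) m := by
  obtain ⟨δ, hδ, hmδ⟩ := exists_pos_le_apply hm
  obtain ⟨n, hn⟩ := exists_nat_dominating k hδ
  obtain ⟨u, rfl⟩ := (ContinuousMap.isUnit_iff_forall_ne_zero m).2 fun x => (hm x).ne'
  have h1 := hasFDerivAt_ringInverse (𝕜 := ℝ) u
  have h2 := (h1.const_mul k).add ((hasFDerivAt_id (𝕜 := ℝ) (u : C(unitInterval, ℝ))).const_smul
    (n : ℝ))
  have h3 := (hasFDerivAt_id (𝕜 := ℝ) (u : C(unitInterval, ℝ))).sub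
    ((weightedMean n).hasFDerivAt.comp _ h2)
  set B := k • (-ContinuousLinearMap.mulLeftRight ℝ C(unitInterval, ℝ) ↑u⁻¹ ↑u⁻¹) +
    (n : ℝ) • ContinuousLinearMap.id ℝ C(unitInterval, ℝ) with hB
  have hBn : ‖weightedMean n ∘L B‖ < 1 := by
    refine (ContinuousLinearMap.opNorm_le_bound _ (M := n / (n + 1)) (by positivity)
      fun w => ?_).trans_lt ((div_lt_one (by positivity)).2 (by linarith))
    refine (norm_weightedMean_le _ _).trans ?_
    have : ‖B w‖ ≤ n * ‖w‖ := by
      rw [ContinuousMap.norm_le _ (by positivity)]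
      intro x
      have e : B w x = (n - k x / (u.val x) ^ 2) * w x := by
        have hux : (u⁻¹).val x = (u.val x)⁻¹ := by
          rw [← Ring.inverse_unit]
          exact ringInverse_apply hm x
        simp [hB, hux]
        ring
      have hux := hm x
      have hle : k x / (u.val x) ^ 2 ≤ n := by
        rw [div_le_iff₀ (by positivity)]
        refine (hn x).trans (mul_le_mul_of_nonneg_left ?_ n.cast_nonneg)
        exact pow_le_pow_left₀ hδ.le (hmδ x) 2
      have h0 : 0 ≤ k x / (u.val x) ^ 2 := div_nonneg (hk x).le (by positivity)
      rw [e, norm_mul]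
      refine mul_le_mul ?_ (w.norm_coe_le_norm x) (norm_nonneg _) n.cast_nonneg
      rw [Real.norm_eq_abs, abs_le]
      constructor <;> linarith
    calc ‖B w‖ / (n + 1) ≤ n * ‖w‖ / (n + 1) := by gcongr
      _ = n / (n + 1) * ‖w‖ := by ring
  obtain ⟨U, hU⟩ := isUnit_one_sub_of_norm_lt_one
    (R := C(unitInterval, ℝ) →L[ℝ] C(unitInterval, ℝ)) hBn
  refine ⟨n, ContinuousLinearEquiv.unitsEquiv ℝ _ U, ?_⟩
  have hU' : (ContinuousLinearEquiv.unitsEquiv ℝ _ U : C(unitInterval, ℝ) →L[ℝ] _) =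
      ContinuousLinearMap.id ℝ _ - weightedMean n ∘L B := by
    ext1 w
    exact DFunLike.congr_fun hU w
  rw [hU']
  exact h3

/-- The regular solution as a function of the parameter `C`. -/
noncomputable def regularSolution (k : C(unitInterval, ℝ)) (hk : ∀ x, 0 < k x) (C : ℝ) :
    C(unitInterval, ℝ) :=
  (exists_isRegularSolution hk C).choose

theorem regularSolution_spec (k : C(unitInterval, ℝ)) (hk : ∀ x, 0 < k x) (C : ℝ) :
    IsRegularSolution k C (regularSolution k hk C) :=
  (exists_isRegularSolution hk C).choose_spec

theorem contDiff_regularSolution (k : C(unitInterval, ℝ)) (hk : ∀ x, 0 < k x) :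
    ContDiff ℝ (⊤ : ℕ∞) (regularSolution k hk) := by
  rw [contDiff_iff_contDiffAt]
  intro C₀
  have hm := regularSolution_spec k hk C₀
  set m := regularSolution k hk C₀
  obtain ⟨n, f', hf'⟩ := hasFDerivAt_regularSolutionMap hk hm.1
  have hsm : ContDiffAt ℝ (⊤ : ℕ∞)
      (fun m => m - weightedMean n (k * Ring.inverse m + (n : ℝ) • m)) m := by
    obtain ⟨u, hu⟩ := (ContinuousMap.isUnit_iff_forall_ne_zero m).2 fun x => (hm.1 x).ne'
    have h1 := contDiffAt_ringInverse (n := (⊤ : ℕ∞)) ℝ u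
    rw [hu] at h1
    exact contDiffAt_id.sub ((weightedMean n).contDiff.contDiffAt.comp m
      ((contDiffAt_const.mul h1).add (contDiffAt_id.const_smul _)))
  have hn : ((⊤ : ℕ∞) : WithTop ℕ∞) ≠ 0 := by simp
  let c : ℝ → C(unitInterval, ℝ) := fun C => (-(C / (n + 1))) • (1 : C(unitInterval, ℝ))
  have hc : ContDiff ℝ (⊤ : ℕ∞) c := by fun_prop
  have hc₀ := (isRegularSolution_iff hm.1 n).1 hm
  have hinv := hsm.to_localInverse hf' hn
  have hright := (hsm.hasStrictFDerivAt' hf' hn).eventually_right_inverse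
  have hval := hsm.localInverse_apply_image hf' hn
  beta_reduce at hinv hright hval
  rw [hc₀] at hinv hright hval
  obtain ⟨δ, hδ, hmδ⟩ := exists_pos_le_apply hm.1
  -- Within distance `δ` of `m` the local inverse stays positive, so uniqueness identifies it with
  -- the regular solution.
  have hball := hinv.continuousAt.eventually (Metric.ball_mem_nhds _ hδ)
  rw [hval] at hball
  have hev := hc.continuous.continuousAt.eventually (hright.and hball)
  refine (hinv.comp C₀ hc.contDiffAt).congr_of_eventuallyEq ?_
  filter_upwards [hev] with C hC
  refine (regularSolution_spec k hk C).unique hk ?_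
  have hpos : ∀ x, 0 < hsm.localInverse hf' hn (c C) x := by
    intro x
    have h1 := hC.2
    rw [dist_eq_norm] at h1
    have h2 := (abs_le.1 ((hsm.localInverse hf' hn (c C) - m).norm_coe_le_norm x)).1
    rw [ContinuousMap.sub_apply] at h2
    linarith [hmδ x]
  exact (isRegularSolution_iff hpos n).2 hC.1

theorem antitone_regularSolution_apply (k : C(unitInterval, ℝ)) (hk : ∀ x, 0 < k x)
    (x : unitInterval) : Antitone fun C => regularSolution k hk C x :=
  fun _ _ h => (regularSolution_spec k hk _).le_of_le hk (regularSolution_spec k hk _) h x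

/-! ### From regular solutions to trajectories -/

/-- The separatrix `v = x m(x)` of a regular solution, extended to a differentiable function
on the real line. -/
noncomputable def separatrixProfile (k : C(unitInterval, ℝ)) (C : ℝ) (m : C(unitInterval, ℝ))
    (x : ℝ) : ℝ :=
  ∫ y in (0 : ℝ)..x, (IccExtend zero_le_one k y / IccExtend zero_le_one m y - C)

theorem IsRegularSolution.continuous_slope {k m : C(unitInterval, ℝ)} {C : ℝ}
    (h : IsRegularSolution k C m) : Continuous fun y =>
      IccExtend zero_le_one k y / IccExtend zero_le_one m y - C := by
  have hk := k.continuous.Icc_extend' (h := zero_le_one)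
  have hm := m.continuous.Icc_extend' (h := zero_le_one)
  exact (hk.div hm fun y => (h.1 _).ne').sub continuous_const

theorem IsRegularSolution.hasDerivAt_separatrixProfile {k m : C(unitInterval, ℝ)} {C : ℝ}
    (h : IsRegularSolution k C m) (x : ℝ) :
    HasDerivAt (separatrixProfile k C m)
      (IccExtend zero_le_one k x / IccExtend zero_le_one m x - C) x :=
  h.continuous_slope.integral_hasStrictDerivAt 0 x |>.hasDerivAt

theorem IsRegularSolution.separatrixProfile_eq {k m : C(unitInterval, ℝ)} {C : ℝ}
    (h : IsRegularSolution k C m) {x : ℝ} (hx : x ∈ Icc (0 : ℝ) 1) :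
    separatrixProfile k C m x = x * IccExtend zero_le_one m x := by
  rw [IccExtend_of_mem _ _ hx]
  conv_rhs => rw [h.2]
  have := mul_weightedMean_zero_apply (k * Ring.inverse m - ContinuousMap.const _ C) ⟨x, hx⟩
  rw [this]
  refine intervalIntegral.integral_congr fun y _ => ?_
  simp only [IccExtend, Function.comp_apply, ContinuousMap.sub_apply, ContinuousMap.mul_apply,
    ContinuousMap.const_apply, ringInverse_apply h.1, div_eq_mul_inv]

/-- Energy balance: `V = x m` satisfies `(V²)' = 2 x k - 2 C V`, and the damping term is strictly
negative inside the interval. -/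
theorem IsRegularSolution.sq_apply_one_lt {k m : C(unitInterval, ℝ)} {C : ℝ}
    (h : IsRegularSolution k C m) (hC : 0 < C) :
    (m 1) ^ 2 < 2 * ∫ x in (0 : ℝ)..1, x * IccExtend zero_le_one k x := by
  have hk := k.continuous.Icc_extend' (h := zero_le_one)
  have hV := h.hasDerivAt_separatrixProfile
  have hVc : Continuous (separatrixProfile k C m) :=
    continuous_iff_continuousAt.2 fun x => (hV x).continuousAt
  have hV0 : separatrixProfile k C m 0 = 0 := by simp [separatrixProfile]
  have hV1 : separatrixProfile k C m 1 = m 1 := by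
    rw [h.separatrixProfile_eq (by simp), IccExtend_of_mem _ _ (by simp), one_mul]
    rfl
  have hftc := intervalIntegral.integral_eq_sub_of_hasDerivAt (a := 0) (b := 1)
    (fun x _ => (hV x).pow 2)
    (Continuous.intervalIntegrable (by have := h.continuous_slope; fun_prop) _ _)
  have e : ∫ x in (0 : ℝ)..1, ((2 : ℕ) : ℝ) * separatrixProfile k C m x ^ (2 - 1) *
      (IccExtend zero_le_one k x / IccExtend zero_le_one m x - C) =
      ∫ x in (0 : ℝ)..1, (2 * (x * IccExtend zero_le_one k x)
        - 2 * C * separatrixProfile k C m x) := by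
    refine intervalIntegral.integral_congr fun x hx => ?_
    rw [uIcc_of_le zero_le_one] at hx
    have hmx : IccExtend zero_le_one m x ≠ 0 := (h.1 _).ne'
    simp only [h.separatrixProfile_eq hx]
    field_simp
    ring
  rw [e, intervalIntegral.integral_sub, intervalIntegral.integral_const_mul,
    intervalIntegral.integral_const_mul, Pi.pow_apply, Pi.pow_apply, hV0, hV1] at hftc
  · have hpos : 0 < ∫ x in (0 : ℝ)..1, separatrixProfile k C m x := by
      refine intervalIntegral.intervalIntegral_pos_of_pos_on (hVc.intervalIntegrable _ _)
        (fun x hx => ?_) one_pos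
      rw [h.separatrixProfile_eq (Ioo_subset_Icc_self hx)]
      exact mul_pos hx.1 (h.1 _)
    have := mul_pos hC hpos
    linarith
  · exact Continuous.intervalIntegrable (by fun_prop) _ _
  · exact Continuous.intervalIntegrable (by fun_prop) _ _

/-- Separation of variables: the time function `∫ 1/μ` has slope at least `1/B`, so it is a
bijection of the line, and `σ` is its inverse. -/
theorem exists_global_solution {μ : ℝ → ℝ} {B : ℝ} (hμ : Continuous μ) (hpos : ∀ x, 0 < μ x)
    (hB : ∀ x, μ x ≤ B) :
    ∃ σ : ℝ → ℝ, σ 0 = 0 ∧ (∀ t, HasDerivAt σ (μ (σ t)) t) ∧ (∀ t, 0 ≤ t → 0 ≤ σ t) ∧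
      Tendsto σ atTop atTop := by
  have hB0 : 0 < B := (hpos 0).trans_le (hB 0)
  have hc : Continuous fun x => (μ x)⁻¹ := hμ.inv₀ fun x => (hpos x).ne'
  let T : ℝ → ℝ := fun x => ∫ y in (0 : ℝ)..x, (μ y)⁻¹
  have hT : ∀ x, HasDerivAt T (μ x)⁻¹ x := fun x =>
    (hc.integral_hasStrictDerivAt 0 x).hasDerivAt
  have hTc : Continuous T := continuous_iff_continuousAt.2 fun x => (hT x).continuousAt
  have hT0 : T 0 = 0 := intervalIntegral.integral_same
  have hmono : StrictMono T := strictMono_of_deriv_pos fun x => by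
    rw [(hT x).deriv]; exact inv_pos.2 (hpos x)
  have hlin : Monotone fun x => T x - B⁻¹ * x := by
    have hd : ∀ x, HasDerivAt (fun x => T x - B⁻¹ * x) ((μ x)⁻¹ - B⁻¹) x := fun x => by
      convert! (hT x).sub ((hasDerivAt_id x).const_mul B⁻¹) using 1
      rw [mul_one]
    refine monotone_of_deriv_nonneg (fun x => (hd x).differentiableAt) fun x => ?_
    rw [(hd x).deriv]
    exact sub_nonneg.2 (inv_anti₀ (hpos x) (hB x))
  have htop : Tendsto T atTop atTop := by
    refine tendsto_atTop_mono' _ ?_ (tendsto_id.const_mul_atTop (inv_pos.2 hB0))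
    filter_upwards [eventually_ge_atTop 0] with x hx
    have := hlin hx
    simp only [hT0] at this
    simp only [id]
    linarith
  have hbot : Tendsto T atBot atBot := by
    refine tendsto_atBot_mono' _ ?_ (tendsto_id.const_mul_atBot (inv_pos.2 hB0))
    filter_upwards [eventually_le_atBot 0] with x hx
    have := hlin hx
    simp only [hT0] at this
    simp only [id]
    linarith
  let e := hmono.orderIsoOfSurjective T (hTc.surjective htop hbot)
  have he : ∀ t, T (e.symm t) = t := fun t => e.apply_symm_apply t
  have he0 : e.symm 0 = 0 := by rw [e.symm_apply_eq]; exact hT0.symm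
  refine ⟨e.symm, he0, fun t => ?_, fun t ht => ?_, e.symm.tendsto_atTop⟩
  · have := HasDerivAt.of_local_left_inverse e.symm.continuous.continuousAt (hT (e.symm t))
      (inv_pos.2 (hpos _)).ne' (Eventually.of_forall he)
    rwa [inv_inv] at this
  · rw [← he0]
    exact e.symm.monotone ht

/-- With `x = exp (-σ)`, motion along the curve becomes `σ' = m(exp (-σ))/(b - a)`. The saddle is
sent to `σ = +∞`, and the speed is positive and bounded. -/
theorem regularSolution_mem_stableSeparatrix {F : ℝ → ℝ} {W : Set ℝ} {a b c : ℝ} (hab : a < b)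
    (hW : Icc a b ⊆ W) {k m : C(unitInterval, ℝ)}
    (hFk : ∀ x ∈ Icc (0 : ℝ) 1, F (b - (b - a) * x) = x * IccExtend zero_le_one k x / (b - a))
    (hm : IsRegularSolution k ((b - a) * c) m) :
    (a, m 1) ∈ stableSeparatrix F W a b c := by
  have hL : 0 < b - a := sub_pos.2 hab
  refine ⟨?_, ⟨le_rfl, hab.le⟩, (hm.1 1).le⟩
  have hmc := m.continuous.Icc_extend' (h := zero_le_one)
  have hmpos : ∀ x, 0 < IccExtend zero_le_one m x := fun x => hm.1 _
  obtain ⟨σ, hσ0, hσ, hσnn, hσtop⟩ := exists_global_solution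
    (μ := fun ζ => IccExtend zero_le_one m (Real.exp (-ζ)) / (b - a)) (B := ‖m‖ / (b - a))
    (by fun_prop) (fun x => div_pos (hmpos _) hL) (fun x => by
      refine div_le_div_of_nonneg_right ?_ hL.le
      exact (le_abs_self _).trans (m.norm_coe_le_norm _))
  have hmem : ∀ t, 0 ≤ t → Real.exp (-σ t) ∈ Icc (0 : ℝ) 1 := fun t ht =>
    ⟨(Real.exp_pos _).le, Real.exp_le_one_iff.2 (neg_nonpos.2 (hσnn t ht))⟩
  have hx : ∀ t, HasDerivAt (fun t => Real.exp (-σ t))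
      (-(Real.exp (-σ t) * IccExtend zero_le_one m (Real.exp (-σ t)) / (b - a))) t := fun t => by
    convert! (hσ t).neg.exp using 1
    simp only [Pi.neg_apply]
    ring
  have hV := hm.hasDerivAt_separatrixProfile
  refine ⟨fun t => (b - (b - a) * Real.exp (-σ t),
    separatrixProfile k ((b - a) * c) m (Real.exp (-σ t))), ?_, ?_, ?_, ?_⟩
  · simp only [hσ0, neg_zero, Real.exp_zero, mul_one, sub_sub_cancel, Prod.mk.injEq, true_and]
    rw [hm.separatrixProfile_eq (by simp), IccExtend_of_mem _ _ (by simp), one_mul]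
    rfl
  · intro t ht
    have h1 := ((hx t).const_mul (b - a)).const_sub b
    have h2 := (hV _).comp t (hx t)
    refine HasDerivAt.hasDerivWithinAt ?_
    convert! h1.prodMk h2 using 1
    have hne := (hmpos (Real.exp (-σ t))).ne'
    simp only [vectorField, hFk _ (hmem t ht), hm.separatrixProfile_eq (hmem t ht), Prod.mk.injEq]
    constructor
    · field_simp
    · field_simp
      ring
  · intro t ht
    have := hmem t ht
    refine hW ⟨?_, ?_⟩ <;> nlinarith [this.1, this.2]
  · have h0 : Tendsto (fun t => Real.exp (-σ t)) atTop (𝓝 0) :=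
      Real.tendsto_exp_neg_atTop_nhds_zero.comp hσtop
    have h1 : Tendsto (fun t => b - (b - a) * Real.exp (-σ t)) atTop (𝓝 b) := by
      simpa using (h0.const_mul (b - a)).const_sub b
    have h2 := (hV 0).continuousAt.tendsto.comp h0
    have h3 : separatrixProfile k ((b - a) * c) m 0 = 0 := intervalIntegral.integral_same
    rw [h3] at h2
    exact h1.prodMk_nhds h2

/-! ### Uniqueness of the point on the separatrix -/

theorem pos_of_lt_of_deriv_neg {F : ℝ → ℝ} {W : Set ℝ} {b u : ℝ} (hF : ContinuousOn F W)
    (hzero : ∀ u ∈ W, F u = 0 ↔ u = b) (hF' : deriv F b < 0) (hu : u < b) (hW : Icc u b ⊆ W) :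
    0 < F u := by
  have hb : F b = 0 := (hzero b (hW ⟨hu.le, le_rfl⟩)).2 rfl
  have hs := eventually_nhdsWithin_sign_eq_of_deriv_neg hF' hb
  have hl : ∀ᶠ x in 𝓝[<] b, x ∈ Ioo u b := Ioo_mem_nhdsLT hu
  obtain ⟨y, hy, hyu⟩ := ((hs.filter_mono nhdsWithin_le_nhds).and hl).exists
  rw [sign_pos (sub_pos.2 hyu.2), sign_eq_one_iff] at hy
  by_contra! hle
  obtain ⟨z, hz, hz0⟩ := intermediate_value_Icc hyu.1.le
    (hF.mono ((Icc_subset_Icc_right hyu.2.le).trans hW)) ⟨hle, hy.le⟩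
  have := (hzero z (hW ⟨hz.1, hz.2.trans hyu.2.le⟩)).1 hz0
  linarith [hz.2, hyu.2]

theorem neg_of_gt_of_deriv_neg {F : ℝ → ℝ} {W : Set ℝ} {b u : ℝ} (hF : ContinuousOn F W)
    (hzero : ∀ u ∈ W, F u = 0 ↔ u = b) (hF' : deriv F b < 0) (hu : b < u) (hW : Icc b u ⊆ W) :
    F u < 0 := by
  have hb : F b = 0 := (hzero b (hW ⟨le_rfl, hu.le⟩)).2 rfl
  have hs := eventually_nhdsWithin_sign_eq_of_deriv_neg hF' hb
  have hl : ∀ᶠ x in 𝓝[>] b, x ∈ Ioo b u := Ioo_mem_nhdsGT hu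
  obtain ⟨y, hy, hyu⟩ := ((hs.filter_mono nhdsWithin_le_nhds).and hl).exists
  rw [sign_neg (sub_neg.2 hyu.1), sign_eq_neg_one_iff] at hy
  by_contra! hle
  obtain ⟨z, hz, hz0⟩ := intermediate_value_Icc hyu.2.le
    (hF.mono ((Icc_subset_Icc_left hyu.1.le).trans hW)) ⟨hy.le, hle⟩
  have := (hzero z (hW ⟨hyu.1.le.trans hz.1, hz.2⟩)).1 hz0
  linarith [hz.1, hyu.1]

theorem exists_isLocalMax_of_tendsto {f : ℝ → ℝ} {l t₁ : ℝ} (hf : ContinuousOn f (Ici 0))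
    (hl : Tendsto f atTop (𝓝 l)) (ht₁ : 0 ≤ t₁) (h0 : f 0 < f t₁) (hlt : l < f t₁) :
    ∃ t > 0, f t₁ ≤ f t ∧ IsLocalMax f t := by
  obtain ⟨t, ht, hmax⟩ := hf.exists_isMaxOn' isClosed_Ici (x₀ := t₁) ht₁ (by
    rw [cocompact_eq_atBot_atTop, inf_sup_right, eventually_sup]
    constructor
    · rw [eventually_inf_principal]
      filter_upwards [eventually_lt_atBot 0] with x hx hx'
      exact absurd hx' (not_le.2 hx)
    · exact ((hl.eventually (Iio_mem_nhds hlt)).mono fun x hx => le_of_lt hx).filter_mono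
        inf_le_left)
  have h1 : f t₁ ≤ f t := hmax ht₁
  have ht0 : 0 < t := lt_of_le_of_ne ht (by rintro rfl; linarith)
  exact ⟨t, ht0, h1, hmax.isLocalMax (Ici_mem_nhds ht0)⟩

theorem IsLocalMax.second_deriv_nonpos {f g : ℝ → ℝ} {t d : ℝ} (hmax : IsLocalMax f t)
    (hf : ∀ᶠ s in 𝓝 t, HasDerivAt f (g s) s) (hg : HasDerivAt g d t) : d ≤ 0 := by
  by_contra! hd
  have hdf : deriv f =ᶠ[𝓝 t] g := hf.mono fun s hs => hs.deriv
  have hdd : deriv (deriv f) t = d := by rw [hdf.deriv_eq, hg.deriv]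
  -- A positive second derivative would make `t` a local minimum as well, so `f` would be locally
  -- constant.
  have hmin := isLocalMin_of_deriv_deriv_pos (hdd.symm ▸ hd) hmax.deriv_eq_zero
    hf.self_of_nhds.continuousAt
  have hconst : f =ᶠ[𝓝 t] fun _ => f t := by
    filter_upwards [hmax, hmin] with s h1 h2 using le_antisymm h1 h2
  have : deriv (deriv f) t = 0 := by
    rw [hconst.deriv.deriv_eq]
    simp
  linarith

/-- Membership in the separatrix constrains only the initial point. An excursion outside `[a, b]`
would have an extremum with `v = 0` and `u'' = -F(u)`, of the wrong sign. -/
theorem fst_mem_Icc_of_tendsto {F : ℝ → ℝ} {W : Set ℝ} {a b c : ℝ} (hab : a < b)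
    (hW : Icc a b ⊆ W) (hF : ContinuousOn F W) (hzero : ∀ u ∈ W, F u = 0 ↔ u = b)
    (hF' : deriv F b < 0) {u v : ℝ → ℝ} (hu0 : u 0 = a) (huc : ContinuousOn u (Ici 0))
    (hu : ∀ t > 0, HasDerivAt u (v t) t) (hv : ∀ t > 0, HasDerivAt v (c * v t - F (u t)) t)
    (huW : ∀ t, 0 ≤ t → u t ∈ W) (hlim : Tendsto u atTop (𝓝 b)) {t : ℝ} (ht : 0 ≤ t) :
    u t ∈ Icc a b := by
  have hu' : ∀ t > 0, ∀ᶠ s in 𝓝 t, HasDerivAt u (v s) s := fun t ht =>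
    eventually_of_mem (Ioi_mem_nhds ht) fun s hs => hu s hs
  constructor
  · by_contra! hlt
    obtain ⟨s, hs, hle, hmax⟩ := exists_isLocalMax_of_tendsto (f := fun t => -u t) (l := -b)
      huc.neg hlim.neg ht (by simp only [hu0]; linarith) (by linarith)
    have hcrit : v s = 0 := by
      have := hmax.hasDerivAt_eq_zero (hu s hs).neg
      linarith
    have h2 := hmax.second_deriv_nonpos ((hu' s hs).mono fun r hr => hr.neg) (hv s hs).neg
    have hsa : u s < a := by linarith
    -- Below `a`, membership in `W` comes from the trajectory, which takes every value between `u s`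
    -- and `a`.
    have hpos := pos_of_lt_of_deriv_neg hF hzero hF' (u := u s) (hsa.trans hab) (by
      intro y hy
      rcases le_total a y with h | h
      · exact hW ⟨h, hy.2⟩
      · obtain ⟨r, hr, rfl⟩ := intermediate_value_Icc' (le_of_lt hs)
          (huc.mono Icc_subset_Ici_self) ⟨hy.1, hu0.symm ▸ h⟩
        exact huW r hr.1)
    rw [hcrit] at h2
    linarith
  · by_contra! hlt
    obtain ⟨s, hs, hle, hmax⟩ := exists_isLocalMax_of_tendsto huc hlim ht
      (by rw [hu0]; linarith) hlt
    have hcrit : v s = 0 := hmax.hasDerivAt_eq_zero (hu s hs)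
    have h2 := hmax.second_deriv_nonpos (hu' s hs) (hv s hs)
    have hneg := neg_of_gt_of_deriv_neg hF hzero hF' (u := u s) (hlt.trans_le hle) (by
      intro y hy
      obtain ⟨r, hr, rfl⟩ := intermediate_value_Icc (le_of_lt hs)
        (huc.mono Icc_subset_Ici_self) ⟨by rw [hu0]; linarith [hy.1], hy.2⟩
      exact huW r hr.1)
    rw [hcrit] at h2
    linarith

/-- The deviation `E = v - V(X)` solves `E' = k/(m (b - a)) E` with positive coefficient. Thus `E²`
is nondecreasing, yet tends to `0`, so `E` vanishes. -/
theorem eq_regularSolution_of_mem_stableSeparatrix {F : ℝ → ℝ} {W : Set ℝ} {a b c y : ℝ}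
    (hab : a < b) (hW : Icc a b ⊆ W) (hF : ContinuousOn F W)
    (hzero : ∀ u ∈ W, F u = 0 ↔ u = b) (hF' : deriv F b < 0) {k m : C(unitInterval, ℝ)}
    (hk : ∀ x, 0 < k x)
    (hFk : ∀ x ∈ Icc (0 : ℝ) 1, F (b - (b - a) * x) = x * IccExtend zero_le_one k x / (b - a))
    (hm : IsRegularSolution k ((b - a) * c) m) (hy : (a, y) ∈ stableSeparatrix F W a b c) :
    y = m 1 := by
  have hL : 0 < b - a := sub_pos.2 hab
  obtain ⟨⟨γ, hγ0, hγ, hγW, hlim⟩, -⟩ := hy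
  have hcont : ContinuousOn γ (Ici 0) := fun t ht => (hγ t ht).continuousWithinAt
  have hγ' : ∀ t > 0, HasDerivAt γ (vectorField F c (γ t)) t := fun t ht =>
    (hγ t (le_of_lt ht)).hasDerivAt (Ici_mem_nhds ht)
  have hu : ∀ t > 0, HasDerivAt (fun t => (γ t).1) (γ t).2 t := fun t ht => by
    simpa [vectorField] using (hγ' t ht).hasFDerivAt.fst.hasDerivAt
  have hv : ∀ t > 0, HasDerivAt (fun t => (γ t).2) (c * (γ t).2 - F (γ t).1) t := fun t ht => by
    simpa [vectorField] using (hγ' t ht).hasFDerivAt.snd.hasDerivAt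
  have hmem : ∀ t, 0 ≤ t → (γ t).1 ∈ Icc a b := fun t ht =>
    fst_mem_Icc_of_tendsto hab hW hF hzero hF' (congrArg Prod.fst hγ0) hcont.fst hu hv hγW
      hlim.fst_nhds ht
  have hmpos : ∀ x, 0 < IccExtend zero_le_one m x := fun x => hm.1 _
  have hkpos : ∀ x, 0 < IccExtend zero_le_one k x := fun x => hk _
  have hV := hm.hasDerivAt_separatrixProfile
  have hVc : Continuous (separatrixProfile k ((b - a) * c) m) :=
    continuous_iff_continuousAt.2 fun x => (hV x).continuousAt
  let X : ℝ → ℝ := fun t => (b - (γ t).1) / (b - a)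
  have hX : ∀ t, 0 ≤ t → X t ∈ Icc (0 : ℝ) 1 := fun t ht =>
    ⟨div_nonneg (sub_nonneg.2 (hmem t ht).2) hL.le,
      (div_le_one hL).2 (by linarith [(hmem t ht).1])⟩
  let E : ℝ → ℝ := fun t => (γ t).2 - separatrixProfile k ((b - a) * c) m (X t)
  have hEd : ∀ t > 0, HasDerivAt E (IccExtend zero_le_one k (X t) /
      (IccExtend zero_le_one m (X t) * (b - a)) * E t) t := fun t ht => by
    have h1 : HasDerivAt X (-(γ t).2 / (b - a)) t := ((hu t ht).const_sub b).div_const _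
    have h2 := (hv t ht).sub ((hV (X t)).comp t h1)
    convert! h2 using 1
    have hF1 : F (γ t).1 = X t * IccExtend zero_le_one k (X t) / (b - a) := by
      rw [← hFk _ (hX t ht.le)]
      congr 1
      simp only [X]
      field_simp
      ring
    have hne := (hmpos (X t)).ne'
    rw [hF1]
    simp only [E]
    rw [hm.separatrixProfile_eq (hX t ht.le)]
    field_simp
    ring
  have hXc : ContinuousOn X (Ici 0) := (continuousOn_const.sub hcont.fst).div_const _
  have hEc : ContinuousOn E (Ici 0) := hcont.snd.sub (hVc.comp_continuousOn hXc)
  have hmono : MonotoneOn (fun t => E t ^ 2) (Ici 0) := by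
    refine monotoneOn_of_deriv_nonneg (convex_Ici 0) (hEc.pow 2) ?_ ?_
    · rw [interior_Ici]
      exact fun t ht => ((hEd t ht).pow 2).differentiableAt.differentiableWithinAt
    · rw [interior_Ici]
      intro t ht
      have h := ((hEd t ht).pow 2).deriv
      simp only [Pi.pow_def] at h
      rw [h]
      have := hkpos (X t)
      have := hmpos (X t)
      have e : ((2 : ℕ) : ℝ) * E t ^ (2 - 1) * (IccExtend zero_le_one k (X t) /
        (IccExtend zero_le_one m (X t) * (b - a)) * E t) = 2 * (IccExtend zero_le_one k (X t) /
        (IccExtend zero_le_one m (X t) * (b - a))) * E t ^ 2 := by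
          push_cast
          ring
      rw [e]
      positivity
  have hElim : Tendsto (fun t => E t ^ 2) atTop (𝓝 0) := by
    have h1 : Tendsto X atTop (𝓝 0) := by
      simpa using (hlim.fst_nhds.const_sub b).div_const (b - a)
    have h2 : Tendsto (fun t => separatrixProfile k ((b - a) * c) m (X t)) atTop (𝓝 0) := by
      have := (hVc.tendsto 0).comp h1
      have h3 : separatrixProfile k ((b - a) * c) m 0 = 0 := intervalIntegral.integral_same
      rwa [h3] at this
    simpa using (hlim.snd_nhds.sub h2).pow 2
  have hE0 : E 0 ^ 2 ≤ 0 := ge_of_tendsto hElim (by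
    filter_upwards [eventually_ge_atTop 0] with t ht
    exact hmono self_mem_Ici ht ht)
  have hE00 : E 0 = 0 := pow_eq_zero_iff (two_ne_zero) |>.1 (le_antisymm hE0 (sq_nonneg _))
  have hX0 : X 0 = 1 := by
    simp only [X, hγ0]
    exact div_self hL.ne'
  simp only [E, hX0, hγ0] at hE00
  rw [hm.separatrixProfile_eq (by simp), IccExtend_of_mem _ _ (by simp), one_mul] at hE00
  exact sub_eq_zero.1 hE00

/-! ### Reduction of `F`, construction of `ψ`, conclusion -/

/-- Here `k` is minus `(b - a)²` times the slope of `F` from `b`: positive at `x = 0` because `F'(b)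
< 0`, elsewhere because `F > 0` left of `b`. -/
theorem exists_reduced_nonlinearity {F : ℝ → ℝ} {W : Set ℝ} {a b : ℝ} (hab : a < b)
    (hWopen : IsOpen W) (hW : Icc a b ⊆ W) (hF : ContinuousOn F W)
    (hzero : ∀ u ∈ W, F u = 0 ↔ u = b) (hF' : deriv F b < 0) :
    ∃ k : C(unitInterval, ℝ), (∀ x, 0 < k x) ∧ ∀ x ∈ Icc (0 : ℝ) 1,
      F (b - (b - a) * x) = x * IccExtend zero_le_one k x / (b - a) := by
  have hL : 0 < b - a := sub_pos.2 hab
  have hbW : b ∈ W := hW ⟨hab.le, le_rfl⟩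
  have hmem : ∀ x ∈ Icc (0 : ℝ) 1, b - (b - a) * x ∈ Icc a b := fun x hx => by
    constructor <;> nlinarith [hx.1, hx.2]
  have hd : ContinuousOn (dslope F b) W :=
    (continuousOn_dslope (hWopen.mem_nhds hbW)).2
      ⟨hF, differentiableAt_of_deriv_ne_zero hF'.ne⟩
  have hslope : ∀ u, F u = (u - b) * dslope F b u := fun u => by
    have := sub_smul_dslope F b u
    rw [(hzero b hbW).2 rfl, sub_zero] at this
    exact this.symm
  let k : C(unitInterval, ℝ) := ⟨fun x => -((b - a) ^ 2 * dslope F b (b - (b - a) * x)), by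
    refine (continuous_const.mul (hd.comp_continuous (by fun_prop) fun x => ?_)).neg
    exact hW (hmem x x.2)⟩
  refine ⟨k, fun x => ?_, fun x hx => ?_⟩
  · change 0 < -((b - a) ^ 2 * dslope F b (b - (b - a) * x))
    rw [← mul_neg]
    refine mul_pos (by positivity) (neg_pos.2 ?_)
    rcases eq_or_lt_of_le x.2.1 with h | h
    · rw [← h, mul_zero, sub_zero, dslope_same]
      exact hF'
    · have hlt : b - (b - a) * x < b := by nlinarith
      have hpos := pos_of_lt_of_deriv_neg hF hzero hF' hlt
        ((Icc_subset_Icc_left (hmem x x.2).1).trans hW)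
      rw [hslope] at hpos
      exact neg_of_mul_pos_right hpos (by linarith)
  · rw [IccExtend_of_mem _ _ hx, hslope]
    change _ = x * -((b - a) ^ 2 * dslope F b (b - (b - a) * x)) / (b - a)
    field_simp
    ring

theorem integral_reduced_nonlinearity {F : ℝ → ℝ} {a b : ℝ} (hab : a < b)
    {k : C(unitInterval, ℝ)}
    (hFk : ∀ x ∈ Icc (0 : ℝ) 1, F (b - (b - a) * x) = x * IccExtend zero_le_one k x / (b - a)) :
    ∫ x in (0 : ℝ)..1, x * IccExtend zero_le_one k x = ∫ u in a..b, F u := by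
  have hL : b - a ≠ 0 := (sub_pos.2 hab).ne'
  have h : ∫ x in (0 : ℝ)..1, x * IccExtend zero_le_one k x =
      ∫ x in (0 : ℝ)..1, (b - a) * F (b - (b - a) * x) := by
    refine intervalIntegral.integral_congr fun x hx => ?_
    rw [uIcc_of_le zero_le_one] at hx
    simp only [hFk x hx]
    field_simp
  rw [h, intervalIntegral.integral_const_mul, intervalIntegral.integral_comp_sub_mul _ hL]
  simp [hL]

theorem tendsto_regularSolution_apply_atTop (k : C(unitInterval, ℝ)) (hk : ∀ x, 0 < k x)
    (x : unitInterval) : Tendsto (fun C => regularSolution k hk C x) atTop (𝓝 0) := by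
  refine tendsto_of_tendsto_of_tendsto_of_le_of_le' tendsto_const_nhds
    (tendsto_const_nhds (x := ‖k‖).div_atTop tendsto_id) ?_ ?_
  · exact Eventually.of_forall fun C => ((regularSolution_spec k hk C).1 x).le
  · filter_upwards [eventually_gt_atTop 0] with C hC
    rw [id, le_div_iff₀ hC, mul_comm]
    exact (regularSolution_spec k hk C).mul_apply_le_norm hk hC.le x

/-- Since `Φ' ≤ 0`, the derivative of `(c r - Φ(c))/q` is at least `r/q > 0`. -/
theorem exists_smooth_inverse_of_antitone {Φ : ℝ → ℝ} {r q : ℝ} (hr : 0 < r) (hq : 0 < q)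
    (hΦ : ContDiff ℝ (⊤ : ℕ∞) Φ) (hanti : Antitone Φ) :
    ∃ ψ : ℝ ≃o ℝ, ContDiff ℝ (⊤ : ℕ∞) ψ ∧ ContDiff ℝ (⊤ : ℕ∞) ψ.symm ∧
      ∀ c, ψ.symm c = (c * r - Φ c) / q := by
  let H : ℝ → ℝ := fun c => (c * r - Φ c) / q
  have hH : ContDiff ℝ (⊤ : ℕ∞) H := by fun_prop
  have hd : ∀ c, HasDerivAt H ((r - deriv Φ c) / q) c := fun c => by
    have h1 := ((hasDerivAt_id c).mul_const r).sub
      (hΦ.differentiable (by simp) c).hasDerivAt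
    rw [one_mul] at h1
    exact h1.div_const q
  have hpos : ∀ c, 0 < (r - deriv Φ c) / q := fun c =>
    div_pos (by linarith [hanti.deriv_nonpos (x := c)]) hq
  have hmono : StrictMono H := strictMono_of_hasDerivAt_pos hd hpos
  have htop : Tendsto H atTop atTop := by
    refine Tendsto.atTop_div_const hq (tendsto_atTop_mono' _ ?_
      (tendsto_atTop_add_const_right _ (-Φ 0) (tendsto_id.atTop_mul_const hr)))
    filter_upwards [eventually_ge_atTop 0] with c hc
    simp only [id]
    linarith [hanti hc]
  have hbot : Tendsto H atBot atBot := by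
    refine Tendsto.atBot_div_const hq (tendsto_atBot_mono' _ ?_
      (tendsto_atBot_add_const_right _ (-Φ 0) (tendsto_id.atBot_mul_const hr)))
    filter_upwards [eventually_le_atBot 0] with c hc
    simp only [id]
    linarith [hanti hc]
  let e := hmono.orderIsoOfSurjective H (hH.continuous.surjective htop hbot)
  refine ⟨e.symm, ?_, hH, fun c => rfl⟩
  exact e.toHomeomorph.contDiff_symm_deriv (fun c => (hpos c).ne') hd hH

theorem OrderIso.isSmoothDiffeoOn_Ici (ψ : ℝ ≃o ℝ) (h : ContDiff ℝ (⊤ : ℕ∞) ψ)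
    (h' : ContDiff ℝ (⊤ : ℕ∞) ψ.symm) (x : ℝ) : IsSmoothDiffeoOn ψ (Ici x) (Ici (ψ x)) := by
  refine ⟨⟨fun y hy => ψ.monotone hy, ψ.injective.injOn, fun y hy => ⟨ψ.symm y, ?_, by simp⟩⟩,
    h.contDiffOn, ψ.symm, h'.contDiffOn, fun y _ => by simp, fun y _ => by simp⟩
  exact ψ.le_symm_apply.2 hy

theorem theorem3 (θhl θp q : ℝ) (F : ℝ → ℝ) (W : Set ℝ)
    (hθhl : 0 < θhl) (hθ : θhl < θp) (hq : 0 < q)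
    (hWopen : IsOpen W) (hW : Icc θhl θp ⊆ W)
    (hF : ContDiffOn ℝ (⊤ : ℕ∞) F W)
    (hzero : ∀ u ∈ W, F u = 0 ↔ u = θp)
    (hF' : deriv F θp < 0) :
    ∃ ψ : ℝ → ℝ,
      (∀ R : ℝ, 0 ≤ R → ∀ c : ℝ, 0 ≤ c →
        ((θhl, c * θhl - q * R) ∈ stableSeparatrix F W θhl θp c ↔ c = ψ R)) ∧
      IsSmoothDiffeoOn ψ (Ici 0) (Ici (ψ 0)) ∧
      0 < ψ 0 ∧
      StrictMonoOn ψ (Ici 0) ∧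
      Tendsto ψ atTop atTop ∧
      Tendsto (fun R => ψ R - q * R / θhl) atTop (𝓝 0) ∧
      ∀ R : ℝ, 0 ≤ R →
        q * R / θhl < ψ R ∧
        ψ R < 1 / θhl * (Real.sqrt (2 * ∫ u in θhl..θp, F u) + q * R) := by
  obtain ⟨k, hk, hFk⟩ := exists_reduced_nonlinearity hθ hWopen hW hF.continuousOn hzero hF'
  have hL : 0 < θp - θhl := sub_pos.2 hθ
  let Φ : ℝ → ℝ := fun c => regularSolution k hk ((θp - θhl) * c) 1
  have hreg := fun c => regularSolution_spec k hk ((θp - θhl) * c)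
  have hΦpos : ∀ c, 0 < Φ c := fun c => (hreg c).1 1
  have heval : ContDiff ℝ (⊤ : ℕ∞) fun m : C(unitInterval, ℝ) => m 1 :=
    (ContinuousMap.evalCLM ℝ (1 : unitInterval) : C(unitInterval, ℝ) →L[ℝ] ℝ).contDiff
  have hΦ : ContDiff ℝ (⊤ : ℕ∞) Φ :=
    heval.comp ((contDiff_regularSolution k hk).comp (contDiff_const.mul contDiff_id))
  have hanti : Antitone Φ := fun c d hcd =>
    antitone_regularSolution_apply k hk 1 (mul_le_mul_of_nonneg_left hcd hL.le)
  have hΦlim : Tendsto Φ atTop (𝓝 0) :=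
    (tendsto_regularSolution_apply_atTop k hk 1).comp (tendsto_id.const_mul_atTop hL)
  obtain ⟨ψ, hψ, hψ', hψs⟩ := exists_smooth_inverse_of_antitone hθhl hq hΦ hanti
  -- Through this identity the bounds on `ψ` and its asymptote become statements about `Φ` at `ψ R`.
  have hrel : ∀ R, ψ R * θhl - Φ (ψ R) = q * R := fun R => by
    have := hψs (ψ R)
    rw [ψ.symm_apply_apply, eq_div_iff hq.ne'] at this
    linarith
  have hψeq : ∀ R, ψ R - q * R / θhl = Φ (ψ R) / θhl := fun R => by
    rw [← hrel]
    field_simp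
    ring
  have hlower : ∀ R, q * R / θhl < ψ R := fun R => by
    have := div_pos (hΦpos (ψ R)) hθhl
    rw [← hψeq] at this
    linarith
  have htop : Tendsto ψ atTop atTop := ψ.tendsto_atTop
  refine ⟨ψ, fun R _ c _ => ?_, ψ.isSmoothDiffeoOn_Ici hψ hψ' 0, ?_, ψ.strictMono.strictMonoOn _,
    htop, ?_, fun R hR => ⟨hlower R, ?_⟩⟩
  · have hmem : (θhl, c * θhl - q * R) ∈ stableSeparatrix F W θhl θp c ↔
        c * θhl - q * R = Φ c := by
      constructor
      · exact eq_regularSolution_of_mem_stableSeparatrix hθ hW hF.continuousOn hzero hF' hk hFk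
          (hreg c)
      · intro h
        rw [h]
        exact regularSolution_mem_stableSeparatrix hθ hW hFk (hreg c)
    rw [hmem, ← ψ.symm_apply_eq, hψs, div_eq_iff hq.ne']
    constructor <;> intro h <;> linarith
  · simpa using hlower 0
  · simp only [hψeq]
    simpa using (hΦlim.comp htop).div_const θhl
  -- The energy inequality is applied at `c = ψ R` and requires `c > 0`.
  · have hψpos : 0 < ψ R := lt_of_le_of_lt (by positivity) (hlower R)
    have hen := (hreg (ψ R)).sq_apply_one_lt (mul_pos hL hψpos)
    rw [integral_reduced_nonlinearity hθ hFk] at hen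
    have hlt := Real.lt_sqrt_of_sq_lt hen
    rw [one_div, inv_mul_eq_div, lt_div_iff₀ hθhl]
    linarith [hrel R]
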